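/- Let $n\ge 2$, let $1\le p<2$, and let $U\subset\mathbb R^n$ be a bounded Lipschitz domain (a bounded, connected, nonempty open set that near each boundary point is, in suitable orthonormal coordinates, the region strictly above the graph of a Lipschitz function). Then there is a constant $C=C(U,p)>0$ such that the following holds. If $0<\varepsilon<1$ and $u\in W^{1,p}(U,\mathbb R^n)$ satisfies $\int_U u\,dx=0$ and $$\int_U \min\{|Du|^2,\ |Du|^p+1\}\,dx<\varepsilon,$$ then $$\int_U \min\{|u|^2+|Du|^2,\ |Du|^p+|u|^p+1\}\,dx< C\,\varepsilon^{p/2}.$$ Here $Du$ is the weak gradient of $u$, and $|\cdot|$ is the Euclidean norm of vectors and the Frobenius norm of matrices. -/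

import Mathlib

open MeasureTheory
open scoped ContDiff

/-- A bounded Lipschitz domain of `ℝⁿ`: a bounded connected (nonempty) open set which near each of
its boundary points lies strictly on one side of a Lipschitz graph, in suitable orthogonal
coordinates. A point is written as `y + t • e`, where `e` is a unit vector (the vertical
direction), `y` is orthogonal to `e` and `t` is the height. -/
structure IsBoundedLipschitzDomain {n : ℕ} (U : Set (EuclideanSpace ℝ (Fin n))) : Prop where
  isOpen : IsOpen U
  isConnected : IsConnected U
  isBounded : Bornology.IsBounded U
  graph : ∀ x₀ ∈ frontier U, ∃ r : ℝ, 0 < r ∧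
    ∃ e : EuclideanSpace ℝ (Fin n), ‖e‖ = 1 ∧
    ∃ (K : NNReal) (γ : ↥(Submodule.span ℝ {e})ᗮ → ℝ), LipschitzWith K γ ∧
      ∀ (y : ↥(Submodule.span ℝ {e})ᗮ) (t : ℝ),
        (y : EuclideanSpace ℝ (Fin n)) + t • e ∈ Metric.ball x₀ r →
          ((y : EuclideanSpace ℝ (Fin n)) + t • e ∈ U ↔ γ y < t)

/-- `g` is the weak partial derivative `∂f/∂xⱼ` of the scalar function `f` in the open set `U`. -/
structure HasWeakPartialDeriv {n : ℕ} (U : Set (EuclideanSpace ℝ (Fin n))) (j : Fin n)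
    (f g : EuclideanSpace ℝ (Fin n) → ℝ) : Prop where
  locallyIntegrableOn : LocallyIntegrableOn f U
  locallyIntegrableOn_deriv : LocallyIntegrableOn g U
  integral_eq : ∀ φ : EuclideanSpace ℝ (Fin n) → ℝ,
    ContDiff ℝ ∞ φ → HasCompactSupport φ → tsupport φ ⊆ U →
      ∫ x in U, f x * fderiv ℝ φ x (EuclideanSpace.single j 1) = -∫ x in U, g x * φ x

/-- `u` belongs to the Sobolev space `W^{1,p}(U, ℝᵐ)` and `Du` is (a representative of) its weak
gradient, the matrix field with entries `(Du x) i j = ∂uᵢ/∂xⱼ (x)`. -/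
structure MemSobolevWithGradient {n m : ℕ} (p : ℝ) (U : Set (EuclideanSpace ℝ (Fin n)))
    (u : EuclideanSpace ℝ (Fin n) → EuclideanSpace ℝ (Fin m))
    (Du : EuclideanSpace ℝ (Fin n) → Matrix (Fin m) (Fin n) ℝ) : Prop where
  memLp : MemLp u (ENNReal.ofReal p) (volume.restrict U)
  memLp_gradient : ∀ i j, MemLp (fun x => Du x i j) (ENNReal.ofReal p) (volume.restrict U)
  hasWeakPartialDeriv : ∀ i j, HasWeakPartialDeriv U j (fun x => u x i) (fun x => Du x i j)

/-- The Euclidean (Frobenius) norm `|A| = (∑ᵢⱼ Aᵢⱼ²)^{1/2}` of a matrix. -/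
noncomputable def matrixNorm {m n : ℕ} (A : Matrix (Fin m) (Fin n) ℝ) : ℝ :=
  Real.sqrt (∑ i, ∑ j, A i j ^ 2)

/-- Jensen's inequality for powers, for the lower Lebesgue integral. -/
theorem rpow_lintegral_le_lintegral_rpow {α : Type*} [MeasurableSpace α] (μ : Measure α)
    [IsProbabilityMeasure μ] {p : ℝ} (hp : 1 ≤ p) {f : α → ENNReal} (hf : AEMeasurable f μ) :
    (∫⁻ x, f x ∂μ) ^ p ≤ ∫⁻ x, f x ^ p ∂μ := by
  have h := eLpNorm'_le_eLpNorm'_mul_rpow_measure_univ (μ := μ) one_pos hp hf.aestronglyMeasurable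
  simp only [eLpNorm', enorm_eq_self, ENNReal.rpow_one, measure_univ, ENNReal.one_rpow, mul_one,
    one_div, inv_one] at h
  have hp0 : 0 < p := by linarith
  calc (∫⁻ x, f x ∂μ) ^ p ≤ ((∫⁻ x, f x ^ p ∂μ) ^ p⁻¹) ^ p := by gcongr
    _ = _ := by rw [← ENNReal.rpow_mul, inv_mul_cancel₀ hp0.ne', ENNReal.rpow_one]

theorem enorm_sub_rpow_le_lintegral_fderiv {V : Type*} [NormedAddCommGroup V]
    [NormedSpace ℝ V] {v : V → ℝ} (hv : ContDiff ℝ 1 v) {p : ℝ} (hp : 1 ≤ p)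
    {R : ℝ} {x z : V} (hR : ‖z - x‖ ≤ R) :
    ‖v x - v z‖ₑ ^ p ≤ ENNReal.ofReal R ^ p *
      ∫⁻ θ in Set.Ioc (0 : ℝ) 1, ‖fderiv ℝ v (x + θ • (z - x))‖ₑ ^ p := by
  have hp0 : 0 ≤ p := by linarith
  have hc : Continuous fun θ : ℝ => fderiv ℝ v (x + θ • (z - x)) :=
    (hv.continuous_fderiv one_ne_zero).comp (by fun_prop)
  have hftc : ∫ θ in (0 : ℝ)..1, fderiv ℝ v (x + θ • (z - x)) (z - x) = v z - v x := by
    have := intervalIntegral.integral_eq_sub_of_hasDerivAt (a := 0) (b := 1)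
      (f := fun θ : ℝ => v (x + θ • (z - x)))
      (f' := fun θ : ℝ => fderiv ℝ v (x + θ • (z - x)) (z - x)) (fun θ _ => by
        have h1 : HasDerivAt (fun θ : ℝ => x + θ • (z - x)) (z - x) θ := by
          simpa using ((hasDerivAt_id θ).smul_const (z - x)).const_add x
        exact ((hv.differentiable one_ne_zero _).hasFDerivAt.comp_hasDerivAt θ h1))
      ((hc.clm_apply continuous_const).intervalIntegrable _ _)
    simpa using this
  have : IsProbabilityMeasure (volume.restrict (Set.Ioc (0 : ℝ) 1)) := ⟨by simp⟩
  rw [← enorm_neg, neg_sub, ← hftc, intervalIntegral.integral_of_le zero_le_one]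
  calc ‖∫ θ in Set.Ioc (0 : ℝ) 1, fderiv ℝ v (x + θ • (z - x)) (z - x)‖ₑ ^ p
      ≤ (∫⁻ θ in Set.Ioc (0 : ℝ) 1, ENNReal.ofReal R * ‖fderiv ℝ v (x + θ • (z - x))‖ₑ) ^ p := by
        gcongr
        refine (enorm_integral_le_lintegral_enorm _).trans ?_
        gcongr with θ
        refine (ContinuousLinearMap.le_opENorm _ _).trans ?_
        rw [mul_comm]
        gcongr
        rw [← ofReal_norm]
        exact ENNReal.ofReal_le_ofReal hR
    _ ≤ ∫⁻ θ in Set.Ioc (0 : ℝ) 1,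
          (ENNReal.ofReal R * ‖fderiv ℝ v (x + θ • (z - x))‖ₑ) ^ p :=
        rpow_lintegral_le_lintegral_rpow _ hp (hc.measurable.enorm.const_mul _).aemeasurable
    _ = _ := by
        simp_rw [ENNReal.mul_rpow_of_nonneg _ _ hp0]
        rw [lintegral_const_mul _ (hc.measurable.enorm.pow_const p)]

section Segments

variable {V : Type*} [NormedAddCommGroup V] [NormedSpace ℝ V] [FiniteDimensional ℝ V]
  [MeasurableSpace V] [BorelSpace V] (μ : Measure V) [μ.IsAddHaarMeasure]

theorem lintegral_comp_add_smul (F : V → ENNReal) (hF : Measurable F) (a : V) {r : ℝ}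
    (hr : r ≠ 0) :
    ∫⁻ z, F (a + r • z) ∂μ = ENNReal.ofReal |(r ^ Module.finrank ℝ V)⁻¹| * ∫⁻ z, F z ∂μ := by
  have h1 : ∫⁻ z, F (a + r • z) ∂μ = ∫⁻ w, F (a + w) ∂(μ.map (r • ·)) := by
    rw [lintegral_map (by fun_prop) (by fun_prop)]
  rw [h1, Measure.map_addHaar_smul μ hr, lintegral_smul_measure, lintegral_add_left_eq_self]
  rfl

theorem lintegral_comp_add_smul_le (F : V → ENNReal) (hF : Measurable F) (a : V) {r : ℝ}
    (hr : 1 / 2 ≤ r) :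
    ∫⁻ z, F (a + r • z) ∂μ ≤ 2 ^ Module.finrank ℝ V * ∫⁻ z, F z ∂μ := by
  have hr0 : 0 < r := by linarith
  rw [lintegral_comp_add_smul μ F hF a hr0.ne']
  gcongr
  rw [abs_of_pos (by positivity), ← inv_pow, ENNReal.ofReal_pow (by positivity)]
  gcongr
  rw [show (2 : ENNReal) = ENNReal.ofReal 2 by simp]
  apply ENNReal.ofReal_le_ofReal
  rw [inv_le_comm₀ hr0 (by norm_num)]
  linarith

theorem lintegral_lintegral_comp_segment_le (F : V → ENNReal) (hF : Measurable F) (S T : Set V)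
    (θ : ℝ) :
    ∫⁻ x in S, ∫⁻ z in T, F (x + θ • (z - x)) ∂μ ∂μ ≤
      2 ^ Module.finrank ℝ V * (μ S + μ T) * ∫⁻ w, F w ∂μ := by
  have key : ∀ (S T : Set V) (θ : ℝ), 1 / 2 ≤ θ →
      ∫⁻ x in S, ∫⁻ z in T, F (x + θ • (z - x)) ∂μ ∂μ ≤
        2 ^ Module.finrank ℝ V * μ S * ∫⁻ w, F w ∂μ := by
    intro S T θ hθ
    calc ∫⁻ x in S, ∫⁻ z in T, F (x + θ • (z - x)) ∂μ ∂μ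
        ≤ ∫⁻ x in S, 2 ^ Module.finrank ℝ V * ∫⁻ w, F w ∂μ ∂μ := by
          gcongr with x
          refine (setLIntegral_le_lintegral _ _).trans ?_
          refine le_trans (le_of_eq ?_)
            (lintegral_comp_add_smul_le μ F hF (x - θ • x) hθ)
          congr 1; ext z; congr 1; module
      _ = _ := by rw [setLIntegral_const]; ring
  rcases le_total (1 / 2) θ with hθ | hθ
  · refine (key S T θ hθ).trans ?_
    gcongr
    exact le_self_add
  · rw [lintegral_lintegral_swap (by
      apply Measurable.aemeasurable
      fun_prop)]
    have h := key T S (1 - θ) (by linarith)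
    refine le_trans (le_of_eq ?_) (h.trans ?_)
    · congr 1; ext z; congr 1; ext x; congr 1; module
    · gcongr
      exact le_add_self

theorem lintegral_lintegral_enorm_sub_rpow_le {v : V → ℝ} (hv : ContDiff ℝ 1 v) {p : ℝ}
    (hp : 1 ≤ p) {R : ℝ} (S T W : Set V) (hW : MeasurableSet W) (A : Set (V × V))
    (hA : ∀ q ∈ A, ‖q.2 - q.1‖ ≤ R ∧ ∀ θ ∈ Set.Ioc (0 : ℝ) 1, q.1 + θ • (q.2 - q.1) ∈ W) :
    ∫⁻ x in S, ∫⁻ z in T, A.indicator (fun q => ‖v q.1 - v q.2‖ₑ ^ p) (x, z) ∂μ ∂μ ≤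
      ENNReal.ofReal R ^ p * (2 ^ Module.finrank ℝ V * (μ S + μ T)) *
        ∫⁻ w in W, ‖fderiv ℝ v w‖ₑ ^ p ∂μ := by
  set F : V → ENNReal := W.indicator fun w => ‖fderiv ℝ v w‖ₑ ^ p with hFdef
  have hF : Measurable F :=
    ((hv.continuous_fderiv one_ne_zero).measurable.enorm.pow_const p).indicator hW
  have hpt : ∀ x z, A.indicator (fun q => ‖v q.1 - v q.2‖ₑ ^ p) (x, z) ≤
      ENNReal.ofReal R ^ p * ∫⁻ θ in Set.Ioc (0 : ℝ) 1, F (x + θ • (z - x)) := by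
    intro x z
    by_cases hq : (x, z) ∈ A
    · rw [Set.indicator_of_mem hq]
      refine (enorm_sub_rpow_le_lintegral_fderiv hv hp (hA _ hq).1).trans ?_
      gcongr 1
      refine setLIntegral_mono_ae' measurableSet_Ioc (Filter.Eventually.of_forall fun θ hθ => ?_)
      rw [hFdef, Set.indicator_of_mem ((hA _ hq).2 θ hθ)]
    · rw [Set.indicator_of_notMem hq]
      exact zero_le
  calc _ ≤ ∫⁻ x in S, ∫⁻ z in T, ENNReal.ofReal R ^ p *
        (∫⁻ θ in Set.Ioc (0 : ℝ) 1, F (x + θ • (z - x))) ∂μ ∂μ := by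
        gcongr with x z
        exact hpt x z
    _ = ENNReal.ofReal R ^ p *
        ∫⁻ θ in Set.Ioc (0 : ℝ) 1, ∫⁻ x in S, ∫⁻ z in T, F (x + θ • (z - x)) ∂μ ∂μ := by
        have hm : Measurable fun y : (V × V) × ℝ => F (y.1.1 + y.2 • (y.1.2 - y.1.1)) :=
          hF.comp (by fun_prop)
        have hm1 : ∀ x, Measurable fun y : V × ℝ => F (x + y.2 • (y.1 - x)) :=
          fun x => hF.comp (by fun_prop)
        have hm2 : Measurable fun y : (V × ℝ) × V => F (y.1.1 + y.1.2 • (y.2 - y.1.1)) :=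
          hF.comp (by fun_prop)
        have hm3 : Measurable fun y : V × V =>
            ∫⁻ θ in Set.Ioc (0 : ℝ) 1, F (y.1 + θ • (y.2 - y.1)) := hm.lintegral_prod_right'
        have hm4 : Measurable fun y : V × ℝ =>
            ∫⁻ z in T, F (y.1 + y.2 • (z - y.1)) ∂μ := hm2.lintegral_prod_right'
        have e1 : ∀ x, ∫⁻ z in T, ENNReal.ofReal R ^ p *
              (∫⁻ θ in Set.Ioc (0 : ℝ) 1, F (x + θ • (z - x))) ∂μ =
            ENNReal.ofReal R ^ p *
              ∫⁻ θ in Set.Ioc (0 : ℝ) 1, ∫⁻ z in T, F (x + θ • (z - x)) ∂μ := by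
          intro x
          have hm5 : Measurable fun z => ∫⁻ θ in Set.Ioc (0 : ℝ) 1, F (x + θ • (z - x)) :=
            hm3.comp measurable_prodMk_left
          rw [lintegral_const_mul _ hm5, lintegral_lintegral_swap (hm1 x).aemeasurable]
        simp_rw [e1]
        rw [lintegral_const_mul _ hm4.lintegral_prod_right',
          lintegral_lintegral_swap hm4.aemeasurable]
    _ ≤ ENNReal.ofReal R ^ p * ∫⁻ θ in Set.Ioc (0 : ℝ) 1,
          2 ^ Module.finrank ℝ V * (μ S + μ T) * ∫⁻ w, F w ∂μ := by
        gcongr with θ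
        exact lintegral_lintegral_comp_segment_le μ F hF S T θ
    _ = _ := by
        rw [hFdef, lintegral_indicator hW]
        simp [mul_assoc]

end Segments

open scoped Convolution in
/-- Convolution with a normalized bump function does not increase the `L^p` norm. -/
theorem ContDiffBump.lintegral_enorm_normed_convolution_rpow_le {V : Type*} [NormedAddCommGroup V]
    [NormedSpace ℝ V] [FiniteDimensional ℝ V] [MeasurableSpace V] [BorelSpace V] {μ : Measure V}
    [μ.IsAddHaarMeasure] (φ : ContDiffBump (0 : V)) {g : V → ℝ} (hg : AEStronglyMeasurable g μ)
    {p : ℝ} (hp : 1 ≤ p) :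
    ∫⁻ x, ‖(φ.normed μ ⋆[ContinuousLinearMap.lsmul ℝ ℝ, μ] g) x‖ₑ ^ p ∂μ ≤
      ∫⁻ x, ‖g x‖ₑ ^ p ∂μ := by
  have hcongr := convolution_congr (ContinuousLinearMap.lsmul ℝ ℝ)
    (Filter.EventuallyEq.refl (ae μ) (φ.normed μ)) hg.ae_eq_mk
  have hm : Measurable (hg.mk g) := hg.stronglyMeasurable_mk.measurable
  rw [hcongr, lintegral_congr_ae (f := fun x => ‖g x‖ₑ ^ p) (g := fun x => ‖hg.mk g x‖ₑ ^ p)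
    (hg.ae_eq_mk.mono fun x hx => by simp only [hx])]
  generalize hg.mk g = h at hm
  have hφm : Measurable fun t => ENNReal.ofReal (φ.normed μ t) :=
    (φ.continuous_normed).measurable.ennreal_ofReal
  set ν := μ.withDensity fun t => ENNReal.ofReal (φ.normed μ t) with hν
  have hprob : IsProbabilityMeasure ν := ⟨by
    rw [hν, withDensity_apply _ MeasurableSet.univ, setLIntegral_univ,
      ← ofReal_integral_eq_lintegral_ofReal φ.integrable_normed
        (Filter.Eventually.of_forall φ.nonneg_normed), φ.integral_normed, ENNReal.ofReal_one]⟩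
  calc ∫⁻ x, ‖(φ.normed μ ⋆[ContinuousLinearMap.lsmul ℝ ℝ, μ] h) x‖ₑ ^ p ∂μ
      ≤ ∫⁻ x, (∫⁻ t, ‖h (x - t)‖ₑ ∂ν) ^ p ∂μ := by
        gcongr with x
        refine (enorm_integral_le_lintegral_enorm _).trans (le_of_eq ?_)
        have hm' : Measurable fun t => ‖h (x - t)‖ₑ :=
          (hm.comp (measurable_const.sub measurable_id)).enorm
        rw [hν, lintegral_withDensity_eq_lintegral_mul _ hφm hm']
        congr 1; ext t
        simp only [ContinuousLinearMap.lsmul_apply, smul_eq_mul, enorm_mul, Pi.mul_apply]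
        rw [Real.enorm_eq_ofReal (φ.nonneg_normed t)]
    _ ≤ ∫⁻ x, ∫⁻ t, ‖h (x - t)‖ₑ ^ p ∂ν ∂μ := by
        gcongr with x
        exact rpow_lintegral_le_lintegral_rpow ν hp
          (hm.comp (measurable_const.sub measurable_id)).enorm.aemeasurable
    _ = ∫⁻ t, ∫⁻ x, ‖h (x - t)‖ₑ ^ p ∂μ ∂ν := by
        apply lintegral_lintegral_swap
        exact ((hm.comp (measurable_fst.sub measurable_snd)).enorm.pow_const p).aemeasurable
    _ = ∫⁻ t, ∫⁻ x, ‖h x‖ₑ ^ p ∂μ ∂ν := by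
        congr 1; ext t
        exact lintegral_sub_right_eq_self (fun x => ‖h x‖ₑ ^ p) t
    _ = _ := by simp

section WeakGradient

variable {n : ℕ}

/-- `f` is a measurable integrable function on `U` with integrable weak gradient `g`. -/
structure HasIntegrableWeakGradient (U : Set (EuclideanSpace ℝ (Fin n)))
    (f : EuclideanSpace ℝ (Fin n) → ℝ) (g : Fin n → EuclideanSpace ℝ (Fin n) → ℝ) : Prop where
  measurable : Measurable f
  integrableOn : IntegrableOn f U
  integrableOn_gradient : ∀ j, IntegrableOn (g j) U
  hasWeakPartialDeriv : ∀ j, HasWeakPartialDeriv U j f (g j)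

open scoped Convolution in
theorem fderiv_normed_convolution_apply_single {U : Set (EuclideanSpace ℝ (Fin n))}
    (hU : MeasurableSet U) {f g : EuclideanSpace ℝ (Fin n) → ℝ} {j : Fin n}
    (hf : IntegrableOn f U) (hfg : HasWeakPartialDeriv U j f g)
    (φ : ContDiffBump (0 : EuclideanSpace ℝ (Fin n))) {x : EuclideanSpace ℝ (Fin n)}
    (hx : Metric.closedBall x φ.rOut ⊆ U) :
    fderiv ℝ (φ.normed volume ⋆[ContinuousLinearMap.lsmul ℝ ℝ, volume] U.indicator f) x
        (EuclideanSpace.single j 1) =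
      (φ.normed volume ⋆[ContinuousLinearMap.lsmul ℝ ℝ, volume] U.indicator g) x := by
  have hli : LocallyIntegrable (U.indicator f) volume :=
    ((integrable_indicator_iff hU).2 hf).locallyIntegrable
  have hφc : ContDiff ℝ ∞ (φ.normed volume) := φ.contDiff_normed
  have hD := φ.hasCompactSupport_normed.hasFDerivAt_convolution_left
    (ContinuousLinearMap.lsmul ℝ ℝ) (μ := (volume : Measure (EuclideanSpace ℝ (Fin n))))
    (hφc.of_le (by simp)) hli x
  have hex : ConvolutionExistsAt (fderiv ℝ (φ.normed volume)) (U.indicator f) x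
      (ContinuousLinearMap.precompL (EuclideanSpace ℝ (Fin n)) (ContinuousLinearMap.lsmul ℝ ℝ))
      volume :=
    (HasCompactSupport.convolutionExists_left _ (φ.hasCompactSupport_normed.fderiv ℝ)
      (hφc.continuous_fderiv (by simp)) hli) x
  rw [hD.fderiv, convolution_eq_swap, ContinuousLinearMap.integral_apply hex.integrable_swap,
    convolution_eq_swap]
  have hψ := hfg.integral_eq (fun t => φ.normed volume (x - t)) (hφc.comp (by fun_prop))
    (φ.hasCompactSupport_normed.comp_homeomorph (Homeomorph.subLeft x)) (by
      refine subset_trans ?_ hx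
      refine closure_minimal (fun t ht => ?_) Metric.isClosed_closedBall
      have : x - t ∈ Metric.ball (0 : EuclideanSpace ℝ (Fin n)) φ.rOut := by
        rw [← φ.support_normed_eq (μ := volume)]; exact ht
      rw [mem_ball_zero_iff] at this
      rw [Metric.mem_closedBall, dist_comm, dist_eq_norm]; exact this.le)
  have hder : ∀ t, fderiv ℝ (fun t => φ.normed volume (x - t)) t (EuclideanSpace.single j 1) =
      -fderiv ℝ (φ.normed volume) (x - t) (EuclideanSpace.single j 1) := by
    intro t
    have h1 : HasFDerivAt (fun t : EuclideanSpace ℝ (Fin n) => x - t)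
        (-ContinuousLinearMap.id ℝ _) t := (hasFDerivAt_id t).const_sub x
    have h2 := ((hφc.differentiable (by simp) (x - t)).hasFDerivAt).comp t h1
    have h3 := h2.fderiv
    simp only [Function.comp_def] at h3
    rw [h3]; simp
  simp only [hder, mul_neg, integral_neg, neg_inj] at hψ
  rw [← integral_indicator hU, ← integral_indicator hU] at hψ
  refine Eq.trans ?_ (hψ.trans ?_)
  · congr 1; ext t
    by_cases ht : t ∈ U <;> simp [ht, ContinuousLinearMap.precompL_apply, mul_comm]
  · congr 1; ext t
    by_cases ht : t ∈ U <;> simp [ht, mul_comm]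

theorem enorm_rpow_le_sum_apply_single (L : EuclideanSpace ℝ (Fin n) →L[ℝ] ℝ) {p : ℝ}
    (hp : 1 ≤ p) :
    ‖L‖ₑ ^ p ≤ (n : ENNReal) ^ (p - 1) * ∑ j, ‖L (EuclideanSpace.single j 1)‖ₑ ^ p := by
  have h1 : ‖L‖ ≤ ∑ j, ‖L (EuclideanSpace.single j 1)‖ := by
    refine L.opNorm_le_bound (by positivity) fun h => ?_
    have hh : h = ∑ j, h j • EuclideanSpace.single j (1 : ℝ) := by
      ext i; simp [Finset.sum_apply, Pi.single_apply]
    conv_lhs => rw [hh]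
    rw [map_sum, Finset.sum_mul]
    refine (norm_sum_le _ _).trans (Finset.sum_le_sum fun j _ => ?_)
    rw [map_smul, norm_smul, mul_comm]
    gcongr
    exact PiLp.norm_apply_le h j
  have h2 : ‖L‖ₑ ≤ ∑ j, ‖L (EuclideanSpace.single j 1)‖ₑ := by
    simp_rw [← ofReal_norm]
    rw [← ENNReal.ofReal_sum_of_nonneg (fun _ _ => norm_nonneg _)]
    exact ENNReal.ofReal_le_ofReal h1
  calc ‖L‖ₑ ^ p ≤ (∑ j, ‖L (EuclideanSpace.single j 1)‖ₑ) ^ p := by gcongr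
    _ ≤ _ := by
      have := ENNReal.rpow_sum_le_const_mul_sum_rpow Finset.univ
        (fun j => ‖L (EuclideanSpace.single j 1)‖ₑ) hp
      simpa using this

end WeakGradient

section PairPoincare

variable {n : ℕ}

/-- The `L^p` Poincaré inequality on `U` for differences of values at pairs in `S × T`. -/
def HasPairPoincare (p : ℝ) (U S T : Set (EuclideanSpace ℝ (Fin n))) : Prop :=
  ∃ C : NNReal, ∀ f g, HasIntegrableWeakGradient U f g →
    ∫⁻ x in S, ∫⁻ z in T, ‖f x - f z‖ₑ ^ p ≤ C * ∑ j, ∫⁻ w in U, ‖g j w‖ₑ ^ p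

open Filter Topology in
open scoped Convolution in
/-- Mollifications of a function on an open set at scales tending to zero: they converge almost
everywhere, and at points `w` deep enough inside `U` their gradients are controlled by `g`. -/
theorem HasIntegrableWeakGradient.exists_smooth_approx {U : Set (EuclideanSpace ℝ (Fin n))}
    (hU : MeasurableSet U) {f : EuclideanSpace ℝ (Fin n) → ℝ}
    {g : Fin n → EuclideanSpace ℝ (Fin n) → ℝ} (h : HasIntegrableWeakGradient U f g) {p : ℝ}
    (hp : 1 ≤ p) :
    ∃ v : ℕ → EuclideanSpace ℝ (Fin n) → ℝ, (∀ k, ContDiff ℝ 1 (v k)) ∧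
      (∀ᵐ x, Tendsto (fun k => v k x) atTop (𝓝 (U.indicator f x))) ∧
      ∀ k : ℕ, ∫⁻ w in {w | Metric.closedBall w (1 / ((k : ℝ) + 1)) ⊆ U}, ‖fderiv ℝ (v k) w‖ₑ ^ p ≤
        (n : ENNReal) ^ (p - 1) * ∑ j, ∫⁻ w in U, ‖g j w‖ₑ ^ p := by
  have hp0 : 0 < p := by linarith
  have hpos : ∀ k : ℕ, 0 < 1 / ((k : ℝ) + 1) := fun k => by positivity
  let φ : ℕ → ContDiffBump (0 : EuclideanSpace ℝ (Fin n)) := fun k =>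
    ⟨1 / ((k : ℝ) + 1) / 2, 1 / ((k : ℝ) + 1), half_pos (hpos k), half_lt_self (hpos k)⟩
  have hli : LocallyIntegrable (U.indicator f) volume :=
    ((integrable_indicator_iff hU).2 h.integrableOn).locallyIntegrable
  have hgm : ∀ j, AEStronglyMeasurable (U.indicator (g j)) volume := fun j =>
    ((integrable_indicator_iff hU).2 (h.integrableOn_gradient j)).aestronglyMeasurable
  refine ⟨fun k => (φ k).normed volume ⋆[ContinuousLinearMap.lsmul ℝ ℝ, volume] U.indicator f,
    fun k => ?_, ?_, fun k => ?_⟩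
  · exact (φ k).hasCompactSupport_normed.contDiff_convolution_left _
      ((φ k).contDiff_normed (n := 1)) hli
  · refine ContDiffBump.ae_convolution_tendsto_right_of_locallyIntegrable (K := 2)
      tendsto_one_div_add_atTop_nhds_zero_nat (Eventually.of_forall fun k => ?_) hli
    simp only [φ]; linarith
  · set W := {w | Metric.closedBall w (1 / ((k : ℝ) + 1)) ⊆ U}
    set D := fun (j : Fin n) =>
      ((φ k).normed volume ⋆[ContinuousLinearMap.lsmul ℝ ℝ, volume] U.indicator (g j))
    have hDc : ∀ j, Continuous (D j) := fun j =>
      ((φ k).hasCompactSupport_normed.contDiff_convolution_left _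
        ((φ k).contDiff_normed (n := 1))
        ((integrable_indicator_iff hU).2 (h.integrableOn_gradient j)).locallyIntegrable).continuous
    calc _ ≤ ∫⁻ w in W, (n : ENNReal) ^ (p - 1) * ∑ j, ‖D j w‖ₑ ^ p := by
          refine setLIntegral_mono ((Finset.measurable_sum _ fun j _ =>
            (hDc j).measurable.enorm.pow_const p).const_mul _) fun w hw => ?_
          refine (enorm_rpow_le_sum_apply_single _ hp).trans (le_of_eq ?_)
          congr 1
          refine Finset.sum_congr rfl fun j _ => ?_
          rw [fderiv_normed_convolution_apply_single hU h.integrableOn (h.hasWeakPartialDeriv j)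
            (φ k) hw]
      _ ≤ ∫⁻ w, (n : ENNReal) ^ (p - 1) * ∑ j, ‖D j w‖ₑ ^ p := setLIntegral_le_lintegral _ _
      _ = (n : ENNReal) ^ (p - 1) * ∑ j, ∫⁻ w, ‖D j w‖ₑ ^ p := by
          rw [lintegral_const_mul _ (Finset.measurable_sum _ fun j _ =>
            (hDc j).measurable.enorm.pow_const p),
            lintegral_finsetSum _ fun j _ => (hDc j).measurable.enorm.pow_const p]
      _ ≤ _ := by
          gcongr (n : ENNReal) ^ (p - 1) * ∑ j, ?_ with j
          refine ((φ k).lintegral_enorm_normed_convolution_rpow_le (hgm j) hp).trans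
            (le_of_eq ?_)
          rw [← lintegral_indicator hU]
          congr 1; ext w
          by_cases hw : w ∈ U <;> simp [hw, hp0]

theorem isOpen_setOf_closedBall_subset {X : Type*} [MetricSpace X] [ProperSpace X]
    {U : Set X} (hU : IsOpen U) (r : ℝ) (hr : 0 ≤ r) :
    IsOpen {w | Metric.closedBall w r ⊆ U} := by
  have : {w | Metric.closedBall w r ⊆ U} = (Metric.cthickening r Uᶜ)ᶜ := by
    ext w
    simp only [Set.mem_ofPred_eq, Set.mem_compl_iff]
    rw [hU.isClosed_compl.cthickening_eq_biUnion_closedBall hr]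
    simp only [Set.mem_iUnion, not_exists, Set.mem_compl_iff, Metric.mem_closedBall]
    constructor
    · intro h x hx hw
      exact hx (h (by rwa [Metric.mem_closedBall, dist_comm]))
    · intro h x hx
      by_contra hxU
      exact h x hxU (by rwa [Metric.mem_closedBall, dist_comm] at hx)
  rw [this]
  exact Metric.isClosed_cthickening.isOpen_compl

open Filter Topology in
/-- The pair Poincaré inequality holds on `S × T` if all segments from `S` to `T` lie in `U`. -/
theorem hasPairPoincare_of_segment_subset {p : ℝ} (hp : 1 ≤ p)
    {U S T : Set (EuclideanSpace ℝ (Fin n))} (hU : IsOpen U) (hUb : Bornology.IsBounded U)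
    (hS : MeasurableSet S) (hT : MeasurableSet T)
    (hST : ∀ x ∈ S, ∀ z ∈ T, segment ℝ x z ⊆ U) : HasPairPoincare p U S T := by
  have hp0 : 0 < p := by linarith
  rcases S.eq_empty_or_nonempty with rfl | ⟨s, hs⟩
  · exact ⟨0, fun f g _ => by simp⟩
  rcases T.eq_empty_or_nonempty with rfl | ⟨t, ht⟩
  · exact ⟨0, fun f g _ => by simp⟩
  have hSU : S ⊆ U := fun x hx => hST x hx t ht (left_mem_segment ℝ x t)
  have hTU : T ⊆ U := fun z hz => hST s hs z hz (right_mem_segment ℝ s z)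
  have hSf : volume S ≠ ⊤ := (hUb.subset hSU).measure_lt_top.ne
  have hTf : volume T ≠ ⊤ := (hUb.subset hTU).measure_lt_top.ne
  obtain ⟨R, hR⟩ := Metric.isBounded_iff.1 hUb
  set C : ENNReal := ENNReal.ofReal R ^ p * (2 ^ Module.finrank ℝ (EuclideanSpace ℝ (Fin n)) *
    (volume S + volume T)) * (n : ENNReal) ^ (p - 1) with hC
  have hCtop : C ≠ ⊤ := by
    rw [hC]
    refine ENNReal.mul_ne_top (ENNReal.mul_ne_top ?_ (ENNReal.mul_ne_top (by simp) (by simp [*])))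
      (ENNReal.rpow_ne_top_of_nonneg (by linarith) (by simp))
    exact ENNReal.rpow_ne_top_of_nonneg hp0.le (by simp)
  refine ⟨C.toNNReal, fun f g hfg => ?_⟩
  rw [ENNReal.coe_toNNReal hCtop]
  obtain ⟨v, hvc, hvlim, hvb⟩ := hfg.exists_smooth_approx hU.measurableSet hp
  set W : ℕ → Set (EuclideanSpace ℝ (Fin n)) := fun k =>
    {w | Metric.closedBall w (1 / ((k : ℝ) + 1)) ⊆ U}
  have hWo : ∀ k, IsOpen (W k) := fun k =>
    isOpen_setOf_closedBall_subset hU _ (by positivity)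
  set A : ℕ → Set (EuclideanSpace ℝ (Fin n) × EuclideanSpace ℝ (Fin n)) := fun k =>
    (S ×ˢ T) ∩ {q | ∀ θ ∈ Set.Icc (0 : ℝ) 1, q.1 + θ • (q.2 - q.1) ∈ W k}
  have hAm : ∀ k, MeasurableSet (A k) := fun k => by
    refine (hS.prod hT).inter (IsOpen.measurableSet ?_)
    rw [isOpen_iff_mem_nhds]
    intro q hq
    refine isCompact_Icc.eventually_forall_of_forall_eventually (x₀ := q) fun θ hθ => ?_
    have hc : Continuous fun y : (EuclideanSpace ℝ (Fin n) × EuclideanSpace ℝ (Fin n)) × ℝ =>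
        y.1.1 + y.2 • (y.1.2 - y.1.1) := by fun_prop
    exact hc.continuousAt.eventually ((hWo k).mem_nhds (hq θ hθ))
  set F : ℕ → EuclideanSpace ℝ (Fin n) × EuclideanSpace ℝ (Fin n) → ENNReal := fun k =>
    (A k).indicator fun q => ‖v k q.1 - v k q.2‖ₑ ^ p
  have hFm : ∀ k, Measurable (F k) := fun k => by
    refine Measurable.indicator ?_ (hAm k)
    have := (hvc k).continuous.measurable
    exact ((this.comp measurable_fst).sub (this.comp measurable_snd)).enorm.pow_const p
  have hFb : ∀ k, ∫⁻ q, F k q ∂((volume.restrict S).prod (volume.restrict T)) ≤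
      C * ∑ j, ∫⁻ w in U, ‖g j w‖ₑ ^ p := fun k => by
    rw [lintegral_prod _ (hFm k).aemeasurable]
    refine (lintegral_lintegral_enorm_sub_rpow_le volume (hvc k) hp (R := R) S T (W k)
      (hWo k).measurableSet (A k) fun q hq => ⟨?_, fun θ hθ => ?_⟩).trans ?_
    · rw [← dist_eq_norm]
      exact hR (hTU hq.1.2) (hSU hq.1.1)
    · exact hq.2 θ (Set.Ioc_subset_Icc_self hθ)
    · rw [hC, mul_assoc _ _ (∑ j, _)]
      gcongr
      exact hvb k
  have hmem : ∀ᵐ q ∂((volume.restrict S).prod (volume.restrict T)), q ∈ S ×ˢ T := by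
    rw [Measure.prod_restrict]
    exact ae_restrict_mem (hS.prod hT)
  have h1 : ∀ᵐ q ∂((volume.restrict S).prod (volume.restrict T)),
      Tendsto (fun k => v k q.1) atTop (𝓝 (U.indicator f q.1)) :=
    Measure.quasiMeasurePreserving_fst.ae (ae_restrict_of_ae hvlim)
  have h2 : ∀ᵐ q ∂((volume.restrict S).prod (volume.restrict T)),
      Tendsto (fun k => v k q.2) atTop (𝓝 (U.indicator f q.2)) :=
    Measure.quasiMeasurePreserving_snd.ae (ae_restrict_of_ae hvlim)
  have hlim : ∀ᵐ q ∂((volume.restrict S).prod (volume.restrict T)),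
      ‖f q.1 - f q.2‖ₑ ^ p = liminf (fun k => F k q) atTop := by
    filter_upwards [hmem, h1, h2] with q hq hq1 hq2
    rw [Set.indicator_of_mem (hSU hq.1)] at hq1
    rw [Set.indicator_of_mem (hTU hq.2)] at hq2
    have ht : Tendsto (fun k => ‖v k q.1 - v k q.2‖ₑ ^ p) atTop (𝓝 (‖f q.1 - f q.2‖ₑ ^ p)) :=
      (ENNReal.continuous_rpow_const.tendsto _).comp ((hq1.sub hq2).enorm)
    refine (Tendsto.liminf_eq (ht.congr' ?_)).symm
    have hseg : IsCompact (segment ℝ q.1 q.2) := by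
      rw [segment_eq_image']
      exact isCompact_Icc.image (by fun_prop)
    obtain ⟨δ, hδ, hδU⟩ := hseg.exists_cthickening_subset_open hU (hST _ hq.1 _ hq.2)
    have hev : ∀ᶠ k : ℕ in atTop, 1 / ((k : ℝ) + 1) < δ :=
      tendsto_one_div_add_atTop_nhds_zero_nat.eventually_lt_const hδ
    filter_upwards [hev] with k hk
    have hqA : q ∈ A k := by
      refine ⟨hq, fun θ hθ => ?_⟩
      have hmem : q.1 + θ • (q.2 - q.1) ∈ segment ℝ q.1 q.2 := by
        rw [segment_eq_image']
        exact ⟨θ, hθ, rfl⟩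
      exact ((Metric.closedBall_subset_closedBall hk.le).trans
        (Metric.closedBall_subset_cthickening hmem δ)).trans hδU
    simp only [F, Set.indicator_of_mem hqA]
  have hfm : Measurable fun q : EuclideanSpace ℝ (Fin n) × EuclideanSpace ℝ (Fin n) =>
      ‖f q.1 - f q.2‖ₑ ^ p :=
    ((hfg.measurable.comp measurable_fst).sub (hfg.measurable.comp measurable_snd)).enorm.pow_const
      p
  calc ∫⁻ x in S, ∫⁻ z in T, ‖f x - f z‖ₑ ^ p
      = ∫⁻ q, ‖f q.1 - f q.2‖ₑ ^ p ∂((volume.restrict S).prod (volume.restrict T)) :=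
        (lintegral_prod _ hfm.aemeasurable).symm
    _ = ∫⁻ q, liminf (fun k => F k q) atTop ∂((volume.restrict S).prod (volume.restrict T)) :=
        lintegral_congr_ae hlim
    _ ≤ liminf (fun k => ∫⁻ q, F k q ∂((volume.restrict S).prod (volume.restrict T))) atTop :=
        lintegral_liminf_le hFm
    _ ≤ _ := by
        refine (liminf_le_liminf (Eventually.of_forall hFb)).trans (le_of_eq ?_)
        exact liminf_const _

end PairPoincare

section PairPoincare

variable {n : ℕ} {p : ℝ} {U S T R : Set (EuclideanSpace ℝ (Fin n))}

theorem HasIntegrableWeakGradient.measurable_enorm_sub_rpow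
    {f : EuclideanSpace ℝ (Fin n) → ℝ} {g : Fin n → EuclideanSpace ℝ (Fin n) → ℝ}
    (h : HasIntegrableWeakGradient U f g) (p : ℝ) :
    Measurable fun q : EuclideanSpace ℝ (Fin n) × EuclideanSpace ℝ (Fin n) =>
      ‖f q.1 - f q.2‖ₑ ^ p :=
  ((h.measurable.comp measurable_fst).sub (h.measurable.comp measurable_snd)).enorm.pow_const p

namespace HasPairPoincare

theorem mono (h : HasPairPoincare p U S T) {S' T' : Set (EuclideanSpace ℝ (Fin n))}
    (hS : S' ⊆ S) (hT : T' ⊆ T) : HasPairPoincare p U S' T' := by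
  obtain ⟨C, hC⟩ := h
  refine ⟨C, fun f g hfg => le_trans ?_ (hC f g hfg)⟩
  exact (lintegral_mono fun x => lintegral_mono_set hT).trans (lintegral_mono_set hS)

theorem symm (h : HasPairPoincare p U S T) : HasPairPoincare p U T S := by
  obtain ⟨C, hC⟩ := h
  refine ⟨C, fun f g hfg => le_trans (le_of_eq ?_) (hC f g hfg)⟩
  rw [lintegral_lintegral_swap (hfg.measurable_enorm_sub_rpow p).aemeasurable]
  exact lintegral_congr fun x => lintegral_congr fun z => by rw [enorm_sub_rev]

theorem union_left {S' : Set (EuclideanSpace ℝ (Fin n))} (h : HasPairPoincare p U S T)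
    (h' : HasPairPoincare p U S' T) : HasPairPoincare p U (S ∪ S') T := by
  obtain ⟨C, hC⟩ := h
  obtain ⟨C', hC'⟩ := h'
  refine ⟨C + C', fun f g hfg => (lintegral_union_le _ _ _).trans ?_⟩
  rw [ENNReal.coe_add, add_mul]
  exact add_le_add (hC f g hfg) (hC' f g hfg)

theorem trans (hp : 1 ≤ p) (h : HasPairPoincare p U S T) (h' : HasPairPoincare p U T R)
    (hS : volume S ≠ ⊤) (hR : volume R ≠ ⊤) (hT0 : volume T ≠ 0) (hT : volume T ≠ ⊤) :
    HasPairPoincare p U S R := by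
  obtain ⟨C, hC⟩ := h
  obtain ⟨C', hC'⟩ := h'
  have htop : (volume T)⁻¹ * (2 ^ (p - 1) * (volume R * C + volume S * C')) ≠ ⊤ :=
    ENNReal.mul_ne_top (ENNReal.inv_ne_top.2 hT0) (ENNReal.mul_ne_top
      (ENNReal.rpow_ne_top_of_nonneg (by linarith) (by simp))
      (ENNReal.add_ne_top.2 ⟨ENNReal.mul_ne_top hR (by simp), ENNReal.mul_ne_top hS (by simp)⟩))
  refine ⟨((volume T)⁻¹ * (2 ^ (p - 1) * (volume R * C + volume S * C'))).toNNReal,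
    fun f g hfg => ?_⟩
  rw [ENNReal.coe_toNNReal htop]
  have hm := hfg.measurable_enorm_sub_rpow p
  have hm1 : ∀ x, Measurable fun z => ‖f x - f z‖ₑ ^ p := fun x => hm.comp measurable_prodMk_left
  have hm2 : Measurable fun x => ∫⁻ w in T, ‖f x - f w‖ₑ ^ p := hm.lintegral_prod_right'
  have hm3 : Measurable fun z => ∫⁻ w in T, ‖f w - f z‖ₑ ^ p := hm.lintegral_prod_left'
  have hpt : ∀ x z, ‖f x - f z‖ₑ ^ p * volume T ≤ 2 ^ (p - 1) *
      ((∫⁻ w in T, ‖f x - f w‖ₑ ^ p) + ∫⁻ w in T, ‖f w - f z‖ₑ ^ p) := by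
    intro x z
    rw [← lintegral_add_left (hm1 x), ← lintegral_const_mul', ← setLIntegral_const]
    · refine lintegral_mono fun w => ?_
      refine le_trans ?_ (ENNReal.rpow_add_le_mul_rpow_add_rpow _ _ hp)
      gcongr
      rw [← sub_add_sub_cancel (f x) (f w) (f z)]
      exact enorm_add_le _ _
    · exact ENNReal.rpow_ne_top_of_nonneg (by linarith) (by simp)
  set I := ∑ j, ∫⁻ w in U, ‖g j w‖ₑ ^ p
  have hint : (∫⁻ x in S, ∫⁻ z in R, ‖f x - f z‖ₑ ^ p) * volume T ≤
      2 ^ (p - 1) * (volume R * C + volume S * C') * I := by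
    calc (∫⁻ x in S, ∫⁻ z in R, ‖f x - f z‖ₑ ^ p) * volume T
        = ∫⁻ x in S, ∫⁻ z in R, ‖f x - f z‖ₑ ^ p * volume T := by
          simp_rw [lintegral_mul_const' _ _ hT]
      _ ≤ ∫⁻ x in S, ∫⁻ z in R, 2 ^ (p - 1) *
            ((∫⁻ w in T, ‖f x - f w‖ₑ ^ p) + ∫⁻ w in T, ‖f w - f z‖ₑ ^ p) :=
          lintegral_mono fun x => lintegral_mono fun z => hpt x z
      _ = 2 ^ (p - 1) * (volume R * (∫⁻ x in S, ∫⁻ w in T, ‖f x - f w‖ₑ ^ p) +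
            volume S * ∫⁻ w in T, ∫⁻ z in R, ‖f w - f z‖ₑ ^ p) := by
          have h2 : (2 : ENNReal) ^ (p - 1) ≠ ⊤ :=
            ENNReal.rpow_ne_top_of_nonneg (by linarith) (by simp)
          simp_rw [lintegral_const_mul' _ _ h2, lintegral_add_left measurable_const,
            setLIntegral_const]
          rw [lintegral_add_right _ measurable_const, lintegral_mul_const' _ _ hR,
            setLIntegral_const, lintegral_lintegral_swap (μ := volume.restrict T) hm.aemeasurable]
          ring
      _ ≤ 2 ^ (p - 1) * (volume R * (C * I) + volume S * (C' * I)) := by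
          gcongr
          · exact hC f g hfg
          · exact hC' f g hfg
      _ = _ := by ring
  rw [mul_assoc, mul_comm, ← div_eq_mul_inv]
  exact (ENNReal.le_div_iff_mul_le (Or.inl hT0) (Or.inl hT)).2 hint

end HasPairPoincare

/-- Near a boundary point of a Lipschitz domain `U`, the points of `U` are joined inside `U` by
segments to all the points of a small ball placed above the boundary point. -/
theorem IsBoundedLipschitzDomain.exists_segment_subset (hU : IsBoundedLipschitzDomain U)
    {x₀ : EuclideanSpace ℝ (Fin n)} (hx₀ : x₀ ∈ closure U) :
    ∃ ρ > 0, ∃ c, ∀ x ∈ U ∩ Metric.ball x₀ ρ, ∀ z ∈ Metric.ball c ρ, segment ℝ x z ⊆ U := by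
  by_cases hxU : x₀ ∈ U
  · obtain ⟨ρ, hρ, hρU⟩ := Metric.isOpen_iff.1 hU.isOpen x₀ hxU
    exact ⟨ρ, hρ, x₀, fun x hx z hz => ((convex_ball x₀ ρ).segment_subset hx.2 hz).trans hρU⟩
  obtain ⟨r, hr, e, he, K, γ, hγ, hgraph⟩ := hU.graph x₀ ⟨hx₀, by rwa [hU.isOpen.interior_eq]⟩
  have hee : inner ℝ e e = (1 : ℝ) := by rw [real_inner_self_eq_norm_sq, he, one_pow]
  have hπ : ∀ v : EuclideanSpace ℝ (Fin n), v - (inner ℝ e v : ℝ) • e ∈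
      (Submodule.span ℝ {e})ᗮ := fun v => by
    rw [Submodule.mem_orthogonal_singleton_iff_inner_right, inner_sub_right, inner_smul_right, hee,
      mul_one, sub_self]
  let Y : EuclideanSpace ℝ (Fin n) → ↥(Submodule.span ℝ {e})ᗮ := fun v => ⟨_, hπ v⟩
  have hgr : ∀ v ∈ Metric.ball x₀ r, (v ∈ U ↔ γ (Y v) < inner ℝ e v) := fun v hv => by
    have hv' : ((Y v : EuclideanSpace ℝ (Fin n)) + (inner ℝ e v : ℝ) • e) = v := by simp [Y]
    have := hgraph (Y v) (inner ℝ e v)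
    rw [hv'] at this
    exact this hv
  have hK : (0 : ℝ) ≤ K := K.2
  set ρ := r / (4 * K + 4) with hρdef
  have hρ : 0 < ρ := by positivity
  have hρr : (4 * K + 4) * ρ = r := by rw [hρdef]; field_simp
  have hKρ : 0 ≤ K * ρ := by positivity
  set h := (4 * K + 2) * ρ with hh
  have hh0 : 0 ≤ h := by positivity
  refine ⟨ρ, hρ, x₀ + h • e, fun x hx z hz => ?_⟩
  have hxb : x ∈ Metric.ball x₀ r := Metric.ball_subset_ball (by nlinarith) hx.2
  have hzb : z ∈ Metric.ball x₀ r := by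
    rw [mem_ball_iff_norm] at hz ⊢
    calc ‖z - x₀‖ = ‖(z - (x₀ + h • e)) + h • e‖ := by congr 1; abel
      _ ≤ ‖z - (x₀ + h • e)‖ + ‖h • e‖ := norm_add_le _ _
      _ < ρ + h := by
          rw [norm_smul, he, mul_one, Real.norm_of_nonneg hh0]
          linarith
      _ ≤ r := by nlinarith
  set v := z - x - h • e with hv
  have hvn : ‖v‖ ≤ 2 * ρ := by
    have h1 := mem_ball_iff_norm.1 hx.2
    have h2 := mem_ball_iff_norm.1 hz
    calc ‖v‖ = ‖(z - (x₀ + h • e)) - (x - x₀)‖ := by rw [hv]; congr 1; abel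
      _ ≤ ‖z - (x₀ + h • e)‖ + ‖x - x₀‖ := norm_sub_le _ _
      _ ≤ 2 * ρ := by linarith
  have hev : |inner ℝ e v| ≤ 2 * ρ := by
    refine (abs_real_inner_le_norm e v).trans ?_
    rwa [he, one_mul]
  have hzx : z - x = v + h • e := by rw [hv]; abel
  have hinner : inner ℝ e (z - x) = inner ℝ e v + h := by
    rw [hzx, inner_add_right, inner_smul_right, hee, mul_one]
  have hYn : ‖(z - x) - (inner ℝ e (z - x) : ℝ) • e‖ ≤ 4 * ρ := by
    have : (z - x) - (inner ℝ e (z - x) : ℝ) • e = v - (inner ℝ e v : ℝ) • e := by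
      rw [hinner, hzx]; module
    rw [this]
    refine (norm_sub_le _ _).trans ?_
    rw [norm_smul, he, mul_one, Real.norm_eq_abs]
    linarith
  intro w hw
  rw [hgr w ((convex_ball x₀ r).segment_subset hxb hzb hw)]
  rw [segment_eq_image'] at hw
  obtain ⟨θ, hθ, rfl⟩ := hw
  have hxγ := (hgr x hxb).1 hx.1
  have hYd : dist (Y (x + θ • (z - x))) (Y x) ≤ θ * (4 * ρ) := by
    rw [Subtype.dist_eq, dist_eq_norm]
    have : (Y (x + θ • (z - x)) : EuclideanSpace ℝ (Fin n)) - Y x =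
        θ • ((z - x) - (inner ℝ e (z - x) : ℝ) • e) := by
      simp only [Y, inner_add_right, inner_smul_right]
      module
    rw [this, norm_smul, Real.norm_of_nonneg hθ.1]
    exact mul_le_mul_of_nonneg_left hYn hθ.1
  have hlip := (le_abs_self _).trans ((hγ.dist_le_mul (Y (x + θ • (z - x))) (Y x)))
  have h3 : (K : ℝ) * dist (Y (x + θ • (z - x))) (Y x) ≤ K * (θ * (4 * ρ)) :=
    mul_le_mul_of_nonneg_left hYd hK
  have h4 : θ * (4 * K * ρ) ≤ θ * (inner ℝ e v + h) := by
    refine mul_le_mul_of_nonneg_left ?_ hθ.1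
    have := (abs_le.1 hev).1
    rw [hh]; linarith
  rw [inner_add_right, inner_smul_right, hinner]
  nlinarith

open Topology in
/-- The pair Poincaré inequality holds on all pairs of points of a bounded Lipschitz domain. -/
theorem IsBoundedLipschitzDomain.hasPairPoincare (hU : IsBoundedLipschitzDomain U) (hp : 1 ≤ p) :
    HasPairPoincare p U U U := by
  have hfin : ∀ {A}, A ⊆ U → volume A ≠ ⊤ := fun hA => (hU.isBounded.subset hA).measure_lt_top.ne
  obtain ⟨x₁, hx₁⟩ := hU.isConnected.nonempty
  have hlocal : ∀ x ∈ U, ∃ A, IsOpen A ∧ x ∈ A ∧ A ⊆ U ∧ HasPairPoincare p U A A := by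
    intro x hx
    obtain ⟨r, hr, hrU⟩ := Metric.isOpen_iff.1 hU.isOpen x hx
    exact ⟨Metric.ball x r, Metric.isOpen_ball, Metric.mem_ball_self hr, hrU,
      hasPairPoincare_of_segment_subset hp hU.isOpen hU.isBounded measurableSet_ball
        measurableSet_ball fun y hy z hz => ((convex_ball x r).segment_subset hy hz).trans hrU⟩
  have hchain : ∀ x ∈ U, ∀ y ∈ U, ∃ A B, IsOpen A ∧ IsOpen B ∧ x ∈ A ∧ y ∈ B ∧ A ⊆ U ∧ B ⊆ U ∧
      HasPairPoincare p U A B := by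
    intro x hx y hy
    refine hU.isConnected.isPreconnected.induction₂ (fun x y => ∃ A B, IsOpen A ∧ IsOpen B ∧
      x ∈ A ∧ y ∈ B ∧ A ⊆ U ∧ B ⊆ U ∧ HasPairPoincare p U A B) ?_ ?_ ?_ hx hy
    · intro x hx
      obtain ⟨A, hA, hxA, hAU, hQ⟩ := hlocal x hx
      filter_upwards [mem_nhdsWithin_of_mem_nhds (hA.mem_nhds hxA)] with y hy
      exact ⟨A, A, hA, hA, hxA, hy, hAU, hAU, hQ⟩
    · rintro x y z hx hy hz ⟨A, B, hA, hB, hxA, hyB, hAU, hBU, hQ⟩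
        ⟨B', D, hB', hD, hyB', hzD, hBU', hDU, hQ'⟩
      refine ⟨A, D, hA, hD, hxA, hzD, hAU, hDU, ?_⟩
      exact (hQ.mono subset_rfl Set.inter_subset_left).trans hp
        (hQ'.mono (Set.inter_subset_right (s := B)) subset_rfl) (hfin hAU) (hfin hDU)
        ((hB.inter hB').measure_pos _ ⟨y, hyB, hyB'⟩).ne'
        (hfin (Set.inter_subset_left.trans hBU))
    · rintro x y hx hy ⟨A, B, hA, hB, hxA, hyB, hAU, hBU, hQ⟩
      exact ⟨B, A, hB, hA, hyB, hxA, hBU, hAU, hQ.symm⟩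
  have hcov : ∃ A, IsOpen A ∧ x₁ ∈ A ∧ A ⊆ U ∧ HasPairPoincare p U (U ∩ closure U) A := by
    refine hU.isBounded.isCompact_closure.induction_on
      (p := fun N => ∃ A, IsOpen A ∧ x₁ ∈ A ∧ A ⊆ U ∧ HasPairPoincare p U (U ∩ N) A)
      ⟨U, hU.isOpen, hx₁, subset_rfl, 0, fun f g _ => by simp⟩ ?_ ?_ ?_
    · rintro N N' hN ⟨A, hA, hxA, hAU, hQ⟩
      exact ⟨A, hA, hxA, hAU, hQ.mono (Set.inter_subset_inter_right U hN) subset_rfl⟩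
    · rintro N N' ⟨A, hA, hxA, hAU, hQ⟩ ⟨A', hA', hxA', hAU', hQ'⟩
      refine ⟨A ∩ A', hA.inter hA', ⟨hxA, hxA'⟩, Set.inter_subset_left.trans hAU, ?_⟩
      rw [Set.inter_union_distrib_left]
      exact (hQ.mono subset_rfl Set.inter_subset_left).union_left
        (hQ'.mono subset_rfl Set.inter_subset_right)
    · intro x hx
      obtain ⟨ρ, hρ, c, hseg⟩ := hU.exists_segment_subset hx
      obtain ⟨s, hsb, hsU⟩ := mem_closure_iff.1 hx _ Metric.isOpen_ball (Metric.mem_ball_self hρ)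
      have hcU : Metric.ball c ρ ⊆ U := fun z hz =>
        hseg s ⟨hsU, hsb⟩ z hz (right_mem_segment ℝ s z)
      have hQ := hasPairPoincare_of_segment_subset hp hU.isOpen hU.isBounded
        (hU.isOpen.inter Metric.isOpen_ball).measurableSet measurableSet_ball hseg
      obtain ⟨A, B, hA, hB, hcA, hxB, hAU, hBU, hQ'⟩ :=
        hchain c (hcU (Metric.mem_ball_self hρ)) x₁ hx₁
      refine ⟨Metric.ball x ρ, mem_nhdsWithin_of_mem_nhds (Metric.ball_mem_nhds x hρ), B, hB, hxB,
        hBU, ?_⟩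
      exact (hQ.mono subset_rfl Set.inter_subset_left).trans hp
        (hQ'.mono (Set.inter_subset_right (s := Metric.ball c ρ)) subset_rfl)
        (hfin Set.inter_subset_left) (hfin hBU)
        ((Metric.isOpen_ball.inter hA).measure_pos _ ⟨c, Metric.mem_ball_self hρ, hcA⟩).ne'
        (hfin (Set.inter_subset_right.trans hAU))
  obtain ⟨A, hA, hxA, hAU, hQ⟩ := hcov
  rw [Set.inter_eq_left.2 subset_closure] at hQ
  exact hQ.trans hp hQ.symm (hfin subset_rfl) (hfin subset_rfl)
    (hA.measure_pos _ ⟨x₁, hxA⟩).ne' (hfin hAU)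

/-- The Poincaré inequality for functions of mean zero on a bounded Lipschitz domain. -/
theorem IsBoundedLipschitzDomain.exists_poincare (hU : IsBoundedLipschitzDomain U) (hp : 1 ≤ p) :
    ∃ C : NNReal, ∀ (f : EuclideanSpace ℝ (Fin n) → ℝ)
      (g : Fin n → EuclideanSpace ℝ (Fin n) → ℝ), IntegrableOn f U →
      (∀ j, IntegrableOn (g j) U) → (∀ j, HasWeakPartialDeriv U j f (g j)) → ∫ x in U, f x = 0 →
      ∫⁻ x in U, ‖f x‖ₑ ^ p ≤ C * ∑ j, ∫⁻ x in U, ‖g j x‖ₑ ^ p := by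
  obtain ⟨C, hC⟩ := hU.hasPairPoincare hp
  have hU0 : volume U ≠ 0 := (hU.isOpen.measure_pos _ hU.isConnected.nonempty).ne'
  have hUt : volume U ≠ ⊤ := hU.isBounded.measure_lt_top.ne
  refine ⟨(volume U)⁻¹.toNNReal * C, fun f₀ g hf₀ hg hfg₀ hmean₀ => ?_⟩
  rw [ENNReal.coe_mul, ENNReal.coe_toNNReal (ENNReal.inv_ne_top.2 hU0)]
  obtain ⟨f, hfm, hff⟩ : ∃ f, Measurable f ∧ f₀ =ᵐ[volume.restrict U] f :=
    ⟨_, hf₀.aestronglyMeasurable.stronglyMeasurable_mk.measurable,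
      hf₀.aestronglyMeasurable.ae_eq_mk⟩
  have hf : IntegrableOn f U := hf₀.congr hff
  have hgrad : HasIntegrableWeakGradient U f g := ⟨hfm, hf, hg, fun j =>
    ⟨hf.locallyIntegrableOn, (hg j).locallyIntegrableOn, fun φ h1 h2 h3 => by
      rw [← (hfg₀ j).integral_eq φ h1 h2 h3]
      refine integral_congr_ae (hff.mono fun x hx => ?_)
      simp only [hx]⟩⟩
  have hmean : ∫ x in U, f x = 0 := by rw [← hmean₀]; exact integral_congr_ae hff.symm
  rw [lintegral_congr_ae (hff.mono fun x hx => by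
    show ‖f₀ x‖ₑ ^ p = ‖f x‖ₑ ^ p
    rw [hx])]
  set ν := (volume U)⁻¹ • volume.restrict U with hν
  have hprob : IsProbabilityMeasure ν := ⟨by simp [hν, ENNReal.inv_mul_cancel hU0 hUt]⟩
  have hfν : Integrable f ν := hf.smul_measure (ENNReal.inv_ne_top.2 hU0)
  have hpt : ∀ x, ‖f x‖ₑ ^ p ≤ (volume U)⁻¹ * ∫⁻ z in U, ‖f x - f z‖ₑ ^ p := by
    intro x
    have h1 : f x = ∫ z, (f x - f z) ∂ν := by
      have h0 : ∫ z, f z ∂ν = 0 := by rw [hν, integral_smul_measure, hmean, smul_zero]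
      rw [integral_sub (integrable_const _) hfν, h0]
      simp
    calc ‖f x‖ₑ ^ p ≤ (∫⁻ z, ‖f x - f z‖ₑ ∂ν) ^ p := by
          gcongr
          conv_lhs => rw [h1]
          exact enorm_integral_le_lintegral_enorm _
      _ ≤ ∫⁻ z, ‖f x - f z‖ₑ ^ p ∂ν :=
          rpow_lintegral_le_lintegral_rpow ν hp (measurable_const.sub hfm).enorm.aemeasurable
      _ = _ := by rw [hν, lintegral_smul_measure, smul_eq_mul]
  calc ∫⁻ x in U, ‖f x‖ₑ ^ p ≤ ∫⁻ x in U, (volume U)⁻¹ * ∫⁻ z in U, ‖f x - f z‖ₑ ^ p :=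
        lintegral_mono hpt
    _ = (volume U)⁻¹ * ∫⁻ x in U, ∫⁻ z in U, ‖f x - f z‖ₑ ^ p :=
        lintegral_const_mul' _ _ (ENNReal.inv_ne_top.2 hU0)
    _ ≤ _ := by
        rw [mul_assoc]
        gcongr
        exact hC f g hgrad

end PairPoincare

section MatrixNorm

variable {m n : ℕ}

theorem matrixNorm_nonneg (A : Matrix (Fin m) (Fin n) ℝ) : 0 ≤ matrixNorm A := Real.sqrt_nonneg _

theorem abs_apply_le_matrixNorm (A : Matrix (Fin m) (Fin n) ℝ) (i : Fin m) (j : Fin n) :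
    |A i j| ≤ matrixNorm A := by
  refine Real.le_sqrt_of_sq_le ?_
  rw [sq_abs]
  exact (Finset.single_le_sum (f := fun j => A i j ^ 2) (fun _ _ => sq_nonneg _)
    (Finset.mem_univ j)).trans (Finset.single_le_sum (f := fun i => ∑ j, A i j ^ 2)
      (fun _ _ => Finset.sum_nonneg fun _ _ => sq_nonneg _) (Finset.mem_univ i))

theorem matrixNorm_le_sum_abs (A : Matrix (Fin m) (Fin n) ℝ) :
    matrixNorm A ≤ ∑ i, ∑ j, |A i j| := by
  refine Real.sqrt_le_iff.2 ⟨by positivity, ?_⟩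
  rw [← Finset.sum_product', ← Finset.sum_product']
  simp_rw [← sq_abs (A _ _)]
  exact Finset.sum_sq_le_sq_sum_of_nonneg fun _ _ => abs_nonneg _

end MatrixNorm

section Scalar

variable {p : ℝ}

theorem rpow_le_min_mul_add {ε t : ℝ} (hp1 : 1 ≤ p) (hp2 : p < 2) (hε : 0 < ε) (ht : 0 ≤ t) :
    t ^ p ≤ min (t ^ 2) (t ^ p + 1) * (1 + ε ^ (p / 2 - 1)) + ε ^ (p / 2) := by
  have hq : 0 < ε ^ (p / 2 - 1) := Real.rpow_pos_of_pos hε _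
  have hq' : 0 < ε ^ (p / 2) := Real.rpow_pos_of_pos hε _
  have htp : 0 ≤ t ^ p := Real.rpow_nonneg ht _
  rcases le_total 1 t with h1 | h1
  · have h2 : t ^ p ≤ t ^ 2 := by
      rw [← Real.rpow_natCast]
      exact Real.rpow_le_rpow_of_exponent_le h1 (by push_cast; linarith)
    have h3 : t ^ p ≤ min (t ^ 2) (t ^ p + 1) := le_min h2 (by linarith)
    nlinarith [mul_nonneg (htp.trans h3) hq.le]
  · have h3 : min (t ^ 2) (t ^ p + 1) = t ^ 2 := min_eq_left (by nlinarith)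
    rw [h3]
    have hε2 : ε ^ (p / 2) = ε * ε ^ (p / 2 - 1) := by
      rw [mul_comm, ← Real.rpow_add_one hε.ne']; congr 1; ring
    rcases le_total (t ^ 2) ε with h4 | h4
    · have : t ^ p ≤ ε ^ (p / 2) := by
        calc t ^ p = (t ^ 2) ^ (p / 2) := by
              rw [← Real.rpow_natCast, ← Real.rpow_mul ht]; congr 1; push_cast; ring
          _ ≤ _ := Real.rpow_le_rpow (by positivity) h4 (by linarith)
      nlinarith [mul_nonneg (sq_nonneg t) hq.le, sq_nonneg t]
    · have ht0 : 0 < t ^ 2 := hε.trans_le h4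
      have : t ^ p ≤ t ^ 2 * ε ^ (p / 2 - 1) := by
        calc t ^ p = (t ^ 2) ^ (1 + (p / 2 - 1)) := by
              rw [← Real.rpow_natCast, ← Real.rpow_mul ht]; congr 1; push_cast; ring
          _ = t ^ 2 * (t ^ 2) ^ (p / 2 - 1) := by rw [Real.rpow_add ht0, Real.rpow_one]
          _ ≤ _ := by
              gcongr 1
              exact Real.rpow_le_rpow_of_nonpos hε h4 (by linarith)
      nlinarith [sq_nonneg t]

theorem min_sq_add_sq_le {a t : ℝ} (hp1 : 1 ≤ p) (hp2 : p < 2) (ha : 0 ≤ a) (ht : 0 ≤ t) :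
    min (a ^ 2 + t ^ 2) (t ^ p + a ^ p + 1) ≤ 2 * (t ^ p + a ^ p) := by
  have htp : 0 ≤ t ^ p := Real.rpow_nonneg ht _
  have hap : 0 ≤ a ^ p := Real.rpow_nonneg ha _
  have hsq : ∀ {s : ℝ}, 0 ≤ s → s ≤ 1 → s ^ 2 ≤ s ^ p := fun {s} h0 h1 => by
    rw [← Real.rpow_natCast]
    exact Real.rpow_le_rpow_of_exponent_ge_of_imp h0 h1 (by push_cast; linarith)
      (fun _ h => by norm_num at h)
  rcases le_total a 1 with h1 | h1
  · rcases le_total t 1 with h2 | h2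
    · exact (min_le_left _ _).trans (by linarith [hsq ha h1, hsq ht h2])
    · exact (min_le_right _ _).trans (by linarith [Real.one_le_rpow h2 (by linarith : 0 ≤ p)])
  · exact (min_le_right _ _).trans (by linarith [Real.one_le_rpow h1 (by linarith : 0 ≤ p)])

end Scalar

section Sobolev

variable {m n : ℕ} {p : ℝ} {U : Set (EuclideanSpace ℝ (Fin n))}
  {u : EuclideanSpace ℝ (Fin n) → EuclideanSpace ℝ (Fin m)}
  {Du : EuclideanSpace ℝ (Fin n) → Matrix (Fin m) (Fin n) ℝ}

theorem MemSobolevWithGradient.memLp_matrixNorm (h : MemSobolevWithGradient p U u Du) :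
    MemLp (fun x => matrixNorm (Du x)) (ENNReal.ofReal p) (volume.restrict U) := by
  have hs : MemLp (fun x => ∑ i, ∑ j, |Du x i j|) (ENNReal.ofReal p) (volume.restrict U) :=
    memLp_finsetSum _ fun i _ => memLp_finsetSum _ fun j _ => (h.memLp_gradient i j).abs
  refine hs.mono ?_ (Filter.Eventually.of_forall fun x => ?_)
  · refine Real.continuous_sqrt.comp_aestronglyMeasurable ?_
    refine Finset.aestronglyMeasurable_fun_sum _ fun i _ =>
      Finset.aestronglyMeasurable_fun_sum _ fun j _ => ?_
    exact (h.memLp_gradient i j).aestronglyMeasurable.pow 2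
  · rw [Real.norm_of_nonneg (matrixNorm_nonneg _)]
    exact (matrixNorm_le_sum_abs _).trans (le_abs_self _)

theorem MeasureTheory.MemLp.integrable_norm_rpow_ofReal {α E : Type*} [MeasurableSpace α]
    [NormedAddCommGroup E] {μ : Measure α} {f : α → E} (hp : 1 ≤ p)
    (h : MemLp f (ENNReal.ofReal p) μ) : Integrable (fun x => ‖f x‖ ^ p) μ := by
  have := h.integrable_norm_rpow (by simp; linarith) (by simp)
  rwa [ENNReal.toReal_ofReal (by linarith)] at this

/-- The Poincaré inequality for vector fields of mean zero on a bounded Lipschitz domain. -/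
theorem IsBoundedLipschitzDomain.exists_integral_norm_rpow_le (hU : IsBoundedLipschitzDomain U)
    (m : ℕ) (hp : 1 ≤ p) :
    ∃ C : ℝ, 0 ≤ C ∧ ∀ (u : EuclideanSpace ℝ (Fin n) → EuclideanSpace ℝ (Fin m))
      (Du : EuclideanSpace ℝ (Fin n) → Matrix (Fin m) (Fin n) ℝ),
      MemSobolevWithGradient p U u Du → ∫ x in U, u x = 0 →
        ∫ x in U, ‖u x‖ ^ p ≤ C * ∫ x in U, matrixNorm (Du x) ^ p := by
  obtain ⟨C, hC⟩ := hU.exists_poincare hp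
  have hp0 : 0 ≤ p := by linarith
  have hUt : volume U ≠ ⊤ := hU.isBounded.measure_lt_top.ne
  have : IsFiniteMeasure (volume.restrict U) := ⟨by simpa using hUt.lt_top⟩
  set C' : ENNReal := (m : ENNReal) ^ (p - 1) * (m * (C * n)) with hC'
  have hC't : C' ≠ ⊤ := by
    refine ENNReal.mul_ne_top (ENNReal.rpow_ne_top_of_nonneg (by linarith) (by simp)) ?_
    finiteness
  refine ⟨C'.toReal, ENNReal.toReal_nonneg, fun u Du h hmean => ?_⟩
  have hp' : 1 ≤ ENNReal.ofReal p := by simpa using hp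
  have hui : ∀ i, IntegrableOn (fun x => u x i) U := fun i => by
    have hu : Integrable u (volume.restrict U) := h.memLp.integrable hp'
    exact (EuclideanSpace.proj (𝕜 := ℝ) i).integrable_comp hu
  have hmi : ∀ i, ∫ x in U, u x i = 0 := fun i => by
    have hu : Integrable u (volume.restrict U) := h.memLp.integrable hp'
    have := (EuclideanSpace.proj i :
      EuclideanSpace ℝ (Fin m) →L[ℝ] ℝ).integral_comp_comm hu
    rw [hmean, map_zero] at this
    exact this
  have hconv : ∀ {f : EuclideanSpace ℝ (Fin n) → ℝ}, (∀ x, 0 ≤ f x) →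
      Integrable (fun x => f x ^ p) (volume.restrict U) →
      ENNReal.ofReal (∫ x in U, f x ^ p) = ∫⁻ x in U, ENNReal.ofReal (f x) ^ p := by
    intro f hf hfi
    rw [ofReal_integral_eq_lintegral_ofReal hfi
      (Filter.Eventually.of_forall fun x => Real.rpow_nonneg (hf x) p)]
    exact lintegral_congr fun x => (ENNReal.ofReal_rpow_of_nonneg (hf x) hp0).symm
  have hIm : Integrable (fun x => matrixNorm (Du x) ^ p) (volume.restrict U) := by
    have := h.memLp_matrixNorm.integrable_norm_rpow_ofReal hp
    simpa only [Real.norm_of_nonneg (matrixNorm_nonneg _)] using this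
  have hmeas : ∀ i, AEMeasurable (fun x => ‖u x i‖ₑ ^ p) (volume.restrict U) := fun i =>
    (hui i).aestronglyMeasurable.enorm.pow_const p
  have hmain : ∫⁻ x in U, ENNReal.ofReal ‖u x‖ ^ p ≤
      C' * ∫⁻ x in U, ENNReal.ofReal (matrixNorm (Du x)) ^ p := by
    calc ∫⁻ x in U, ENNReal.ofReal ‖u x‖ ^ p
        ≤ ∫⁻ x in U, (m : ENNReal) ^ (p - 1) * ∑ i, ‖u x i‖ₑ ^ p := by
          refine lintegral_mono fun x => ?_
          have h1 : ENNReal.ofReal ‖u x‖ ≤ ∑ i, ‖u x i‖ₑ := by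
            rw [ofReal_norm]
            have hh : u x = ∑ i, u x i • EuclideanSpace.single i (1 : ℝ) := by
              ext j; simp [Finset.sum_apply, Pi.single_apply]
            conv_lhs => rw [hh]
            refine (enorm_sum_le _ _).trans (le_of_eq ?_)
            refine Finset.sum_congr rfl fun i _ => ?_
            rw [enorm_smul, ← ofReal_norm (EuclideanSpace.single i (1 : ℝ))]
            simp
          have h2 := ENNReal.rpow_sum_le_const_mul_sum_rpow Finset.univ (fun i => ‖u x i‖ₑ) hp
          rw [Finset.card_univ, Fintype.card_fin] at h2
          exact (ENNReal.rpow_le_rpow h1 hp0).trans h2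
      _ = (m : ENNReal) ^ (p - 1) * ∑ i, ∫⁻ x in U, ‖u x i‖ₑ ^ p := by
          rw [lintegral_const_mul' _ _ (ENNReal.rpow_ne_top_of_nonneg (by linarith) (by simp)),
            lintegral_finsetSum' _ fun i _ => hmeas i]
      _ ≤ (m : ENNReal) ^ (p - 1) * ∑ i : Fin m, C * ∑ j : Fin n,
            ∫⁻ x in U, ENNReal.ofReal (matrixNorm (Du x)) ^ p := by
          gcongr (m : ENNReal) ^ (p - 1) * ∑ i, ?_ with i
          refine (hC (fun x => u x i) (fun j x => Du x i j) (hui i)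
            (fun j => (h.memLp_gradient i j).integrable hp') (h.hasWeakPartialDeriv i)
            (hmi i)).trans ?_
          gcongr (C : ENNReal) * ∑ j, ?_ with j
          refine lintegral_mono fun x => ENNReal.rpow_le_rpow ?_ hp0
          rw [← ofReal_norm, Real.norm_eq_abs]
          exact ENNReal.ofReal_le_ofReal (abs_apply_le_matrixNorm _ i j)
      _ = _ := by
          simp only [Finset.sum_const, Finset.card_univ, Fintype.card_fin, nsmul_eq_mul, hC']
          ring
  have hI0 : 0 ≤ ∫ x in U, matrixNorm (Du x) ^ p :=
    integral_nonneg fun x => Real.rpow_nonneg (matrixNorm_nonneg _) _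
  rw [← hconv (fun x => norm_nonneg _) (h.memLp.integrable_norm_rpow_ofReal hp),
    ← hconv (fun x => matrixNorm_nonneg _) hIm, ← ENNReal.ofReal_toReal hC't,
    ← ENNReal.ofReal_mul ENNReal.toReal_nonneg] at hmain
  exact (ENNReal.ofReal_le_ofReal_iff (mul_nonneg ENNReal.toReal_nonneg hI0)).1 hmain

theorem MemSobolevWithGradient.integral_matrixNorm_rpow_le (hp1 : 1 ≤ p) (hp2 : p < 2)
    (hU : volume U ≠ ⊤) (h : MemSobolevWithGradient p U u Du) {ε : ℝ} (hε : 0 < ε) (hε1 : ε < 1)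
    (hlt : ∫ x in U, min (matrixNorm (Du x) ^ 2) (matrixNorm (Du x) ^ p + 1) < ε) :
    ∫ x in U, matrixNorm (Du x) ^ p ≤ (2 + volume.real U) * ε ^ (p / 2) := by
  have : IsFiniteMeasure (volume.restrict U) := ⟨by simpa using hU.lt_top⟩
  have hIm : Integrable (fun x => matrixNorm (Du x) ^ p) (volume.restrict U) := by
    have := h.memLp_matrixNorm.integrable_norm_rpow_ofReal hp1
    simpa only [Real.norm_of_nonneg (matrixNorm_nonneg _)] using this
  have hmm := h.memLp_matrixNorm.aestronglyMeasurable
  have hV : Integrable (fun x => min (matrixNorm (Du x) ^ 2) (matrixNorm (Du x) ^ p + 1))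
      (volume.restrict U) := by
    refine (hIm.add (integrable_const (1 : ℝ))).mono'
      ((hmm.pow 2).inf (hIm.aestronglyMeasurable.add aestronglyMeasurable_const))
      (Filter.Eventually.of_forall fun x => ?_)
    have h0 : 0 ≤ matrixNorm (Du x) ^ p := Real.rpow_nonneg (matrixNorm_nonneg _) _
    rw [Real.norm_of_nonneg (le_min (sq_nonneg _) (by linarith))]
    exact min_le_right _ _
  have hq : 0 < ε ^ (p / 2 - 1) := Real.rpow_pos_of_pos hε _
  have hε2 : ε ^ (p / 2) = ε * ε ^ (p / 2 - 1) := by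
    rw [mul_comm, ← Real.rpow_add_one hε.ne']; congr 1; ring
  have hε3 : ε ≤ ε ^ (p / 2) := by
    conv_lhs => rw [← Real.rpow_one ε]
    exact Real.rpow_le_rpow_of_exponent_ge hε hε1.le (by linarith)
  calc ∫ x in U, matrixNorm (Du x) ^ p
      ≤ ∫ x in U, (min (matrixNorm (Du x) ^ 2) (matrixNorm (Du x) ^ p + 1) *
          (1 + ε ^ (p / 2 - 1)) + ε ^ (p / 2)) :=
        integral_mono hIm ((hV.mul_const _).add (integrable_const _)) fun x =>
          rpow_le_min_mul_add hp1 hp2 hε (matrixNorm_nonneg _)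
    _ = (∫ x in U, min (matrixNorm (Du x) ^ 2) (matrixNorm (Du x) ^ p + 1)) *
          (1 + ε ^ (p / 2 - 1)) + volume.real U * ε ^ (p / 2) := by
        rw [integral_add (hV.mul_const _) (integrable_const _), integral_mul_const]
        simp
    _ ≤ ε * (1 + ε ^ (p / 2 - 1)) + volume.real U * ε ^ (p / 2) := by gcongr
    _ ≤ _ := by rw [mul_add, ← hε2]; linarith

end Sobolev

theorem proposition2p4 (n : ℕ) (hn : 2 ≤ n) (p : ℝ) (hp1 : 1 ≤ p) (hp2 : p < 2)
    (U : Set (EuclideanSpace ℝ (Fin n))) (hU : IsBoundedLipschitzDomain U) :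
    ∃ C : ℝ, 0 < C ∧
      ∀ (u : EuclideanSpace ℝ (Fin n) → EuclideanSpace ℝ (Fin n))
        (Du : EuclideanSpace ℝ (Fin n) → Matrix (Fin n) (Fin n) ℝ) (ε : ℝ),
        MemSobolevWithGradient p U u Du →
        ∫ x in U, u x = 0 →
        0 < ε → ε < 1 →
        ∫ x in U, min (matrixNorm (Du x) ^ 2) (matrixNorm (Du x) ^ p + 1) < ε →
        IntegrableOn (fun x => min (‖u x‖ ^ 2 + matrixNorm (Du x) ^ 2)
          (matrixNorm (Du x) ^ p + ‖u x‖ ^ p + 1)) U ∧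
        ∫ x in U, min (‖u x‖ ^ 2 + matrixNorm (Du x) ^ 2)
          (matrixNorm (Du x) ^ p + ‖u x‖ ^ p + 1) < C * ε ^ (p / 2) := by
  obtain ⟨C, hC0, hC⟩ := hU.exists_integral_norm_rpow_le n hp1
  have hUt : volume U ≠ ⊤ := hU.isBounded.measure_lt_top.ne
  refine ⟨2 * ((1 + C) * (2 + volume.real U)) + 1, by positivity,
    fun u Du ε h hmean hε hε1 hlt => ?_⟩
  have hIm : Integrable (fun x => matrixNorm (Du x) ^ p) (volume.restrict U) := by
    have := h.memLp_matrixNorm.integrable_norm_rpow_ofReal hp1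
    simpa only [Real.norm_of_nonneg (matrixNorm_nonneg _)] using this
  have hIu : Integrable (fun x => ‖u x‖ ^ p) (volume.restrict U) :=
    h.memLp.integrable_norm_rpow_ofReal hp1
  have hle : ∀ x, min (‖u x‖ ^ 2 + matrixNorm (Du x) ^ 2)
      (matrixNorm (Du x) ^ p + ‖u x‖ ^ p + 1) ≤ 2 * (matrixNorm (Du x) ^ p + ‖u x‖ ^ p) :=
    fun x => min_sq_add_sq_le hp1 hp2 (norm_nonneg _) (matrixNorm_nonneg _)
  have hbound := (hIm.add hIu).const_mul 2
  have hint : IntegrableOn (fun x => min (‖u x‖ ^ 2 + matrixNorm (Du x) ^ 2)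
      (matrixNorm (Du x) ^ p + ‖u x‖ ^ p + 1)) U := by
    refine hbound.mono' (((h.memLp.aestronglyMeasurable.norm.pow 2).add
      (h.memLp_matrixNorm.aestronglyMeasurable.pow 2)).inf
      ((hIm.add hIu).aestronglyMeasurable.add aestronglyMeasurable_const))
      (Filter.Eventually.of_forall fun x => ?_)
    have h0 : 0 ≤ matrixNorm (Du x) ^ p := Real.rpow_nonneg (matrixNorm_nonneg _) _
    rw [Real.norm_of_nonneg (le_min (by positivity) (by positivity))]
    exact hle x
  refine ⟨hint, ?_⟩
  have hDu := h.integral_matrixNorm_rpow_le hp1 hp2 hUt hε hε1 hlt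
  have hu := hC u Du h hmean
  have hq : 0 < ε ^ (p / 2) := Real.rpow_pos_of_pos hε _
  calc ∫ x in U, min (‖u x‖ ^ 2 + matrixNorm (Du x) ^ 2)
        (matrixNorm (Du x) ^ p + ‖u x‖ ^ p + 1)
      ≤ ∫ x in U, 2 * (matrixNorm (Du x) ^ p + ‖u x‖ ^ p) := integral_mono hint hbound hle
    _ = 2 * ((∫ x in U, matrixNorm (Du x) ^ p) + ∫ x in U, ‖u x‖ ^ p) := by
        rw [integral_const_mul, integral_add hIm hIu]
    _ ≤ 2 * ((1 + C) * ∫ x in U, matrixNorm (Du x) ^ p) := by linarith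
    _ ≤ 2 * ((1 + C) * ((2 + volume.real U) * ε ^ (p / 2))) := by gcongr
    _ < _ := by linarith
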